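/- **Setting.** There are $U\ge 1$ users, $K\ge 1$ arms and a horizon $T\ge \max\{U,K\}$. User $u$'s reward from arm $k$ has a law $D_{u,k}$ supported on $[0,1]$ with mean $\theta_{u,k}$, and $\Theta=(\theta_{u,k})$; rewards are independent across users, arms and rounds. Arm $k$ has a cost $c_k\in\mathbb N$ with $c_k\le B$, where $B\in\mathbb N$ is the budget. A matching $\pi:[U]\to[K]$ has value $V(\pi;\Theta)=\sum_u\theta_{u,\pi(u)}$ and is feasible if $\sum_{k\in\mathrm{Im}(\pi)}c_k\le B$; $\Pi$ is the set of feasible matchings. In each round $t$ a learner $\mathcal A$ picks a matching $\pi_t$ as a (measurable) function of the past matchings and observed rewards, and then observes $r^t_{u,\pi_t(u)}\sim D_{u,\pi_t(u)}$ for every $u$. Its regret on the instance $\mathcal I$ is $$R_T(\mathcal A,\mathcal I)=T\max_{\pi\in\Pi}V(\pi;\Theta)-\mathbb E\Big[\sum_{t=1}^T\sum_{u} r^t_{u,\pi_t(u)}\Big].$$ A matrix is *perfectly single-peaked* (PSP) if every row is non-decreasing up to some index (a *peak* of the row) and non-increasing from it on; it is *single-peaked* (SP) with respect to a total order $\prec$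 on the arms if permuting its columns according to $\prec$ makes it PSP, and SP if such an order exists. An instance is SP if $\Theta$ is. The order is not known to the learner. **The algorithm EMC($N$).** Let $\varepsilon=\sqrt{2\ln T/N}$. 1. *Explore.* For $k=1,\dots,K$ in turn, match all users with arm $k$ for $N$ rounds; let $\bar\Theta$ be the matrix of empirical means. 2. *Extract-Order.* For each user $u$ sort the arms so that $\bar\Theta_{u,k^u_1}\ge\dots\ge\bar\Theta_{u,k^u_K}$ and, for each $i<K$ with $\bar\Theta_{u,k^u_i}-\bar\Theta_{u,k^u_{i+1}}>2\varepsilon$, require $\{k^u_1,\dots,k^u_i\}$ to be contiguous. Let $\prec$ be any order that meets all these requirements; if there is none, the procedure fails, and an arbitrary feasible matching $\tilde\pi$ is used in step 5. 3. *Project.* With $p(u)\in\arg\max_k\bar\Theta_{u,k}$, let $\tilde\Theta_{u,k}=\max_{i\preceq k}\bar\Theta_{u,i}$ if $k\preceq p(u)$, and $\tilde\Theta_{u,k}=\max_{i\succeq k}\bar\Theta_{u,i}$ otherwise. 4. *SP-Matching.* Relabel the arms by $1,\dots,K$ along $\prec$, let $P$ be the relabelled $\tilde\Theta$, with $q(u)$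 a peak of row $u$ of $P$, and add an arm $0$ with $c_0=0$, $P_{u,0}=0$. Put $F(0,b)=0$ and, for $k\ge1$, $b\ge c_k$, $$F(k,b)=\max_{0\le i<k,\ c_i+c_k\le b}\Big[F(i,b-c_k)+\sum_{u:\,i<q(u)\le k}\max\{P_{u,i},P_{u,k}\}\Big].$$ Choose $k\in[K]$ maximizing $F(k,B)+\sum_{u:\,q(u)>k}P_{u,k}$, backtrack from $(k,B)$ through maximizers to a set $S$ of arms (arm $0$ excluded), and let $\tilde\pi(u)\in\arg\max_{k\in S}P_{u,k}$, translated back to the original labels. 5. *Commit.* Play $\tilde\pi$ in all remaining rounds. If $NK\ge T$, only the first $T$ exploration rounds take place. All ties and free choices (sorting, order, peaks, backtracking, maximizers, the matching used on failure) may be resolved arbitrarily, as long as $\tilde\pi$ is a measurable function of the exploration data. (If $T=1$, then $N=0$ below, $U=K=1$ and there is only one matching; read $0/0$ as $0$.) **Theorem.** There is a universal constant $C>0$ such that for all $U,K\ge1$ and all $T\ge\max\{U,K\}$, on every SP instance $\mathcal I$, EMC($N$) with $N=\lceil T^{2/3}(\ln T)^{1/3}\rceil$ (with the choices resolved in any way)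 plays a feasible matching in every round and satisfies $$R_T(\mathrm{EMC}(N),\mathcal I)\le C\,U K\,T^{2/3}(\ln T)^{1/3}.$$ -/

import Mathlib

open MeasureTheory

noncomputable section

/-! ### The model -/

/-- A matching assigns one arm to every user. -/
abbrev Matching (U K : ℕ) := Fin U → Fin K

/-- The problem data of a constrained bandit recommendation instance with `U` users and `K` arms:
reward distributions supported on `[0,1]`, integer costs, and a budget covering each single arm. -/
structure CBR (U K : ℕ) where
  D : Fin U → Fin K → Measure ℝ
  prob : ∀ u k, IsProbabilityMeasure (D u k)
  supp : ∀ u k, D u k (Set.Icc 0 1)ᶜ = 0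
  c : Fin K → ℕ
  B : ℕ
  cost_le : ∀ k, c k ≤ B

/-- The expected reward matrix. -/
def CBR.mean {U K : ℕ} (I : CBR U K) (u : Fin U) (k : Fin K) : ℝ := ∫ x, x ∂(I.D u k)

/-- The value of a matching with respect to a reward matrix. -/
def matchValue {U K : ℕ} (P : Fin U → Fin K → ℝ) (π : Matching U K) : ℝ := ∑ u, P u (π u)

/-- The selected arms cost at most `B` in total (every selected arm is paid once). -/
def Feasible {U K : ℕ} (c : Fin K → ℕ) (B : ℕ) (π : Matching U K) : Prop :=
  ∑ k ∈ Finset.univ.image π, c k ≤ B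

/-- What the learner has seen after `t` rounds: the matchings played, and for every user the
observed reward of the arm that the user was matched with. -/
abbrev History (U K t : ℕ) := Fin t → Matching U K × (Fin U → ℝ)

/-- A learner chooses the matching of round `t` (rounds are numbered from `0`) as a measurable
function of the history. -/
structure Learner (U K : ℕ) where
  act : (t : ℕ) → History U K t → Matching U K
  measurable_act : ∀ t, Measurable (act t)

/-- The history produced by a learner on a reward table `x`, where `x (t, u, k)` is the reward
that user `u` has in round `t` if matched with arm `k`. -/
def Learner.history {U K : ℕ} (A : Learner U K) (x : ℕ × Fin U × Fin K → ℝ) :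
    (t : ℕ) → History U K t
  | 0 => Fin.elim0
  | t + 1 =>
      Fin.snoc (α := fun _ => Matching U K × (Fin U → ℝ)) (A.history x t)
        (A.act t (A.history x t), fun u => x (t, u, A.act t (A.history x t) u))

/-- The matching that the learner plays in round `t`. -/
def Learner.play {U K : ℕ} (A : Learner U K) (x : ℕ × Fin U × Fin K → ℝ) (t : ℕ) :
    Matching U K :=
  A.act t (A.history x t)

/-- The law of the reward table: all entries are independent, entry `(t, u, k)` has law `D u k`. -/
def CBR.law {U K : ℕ} (I : CBR U K) : Measure (ℕ × Fin U × Fin K → ℝ) :=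
  haveI := I.prob
  Measure.infinitePi fun i : ℕ × Fin U × Fin K => I.D i.2.1 i.2.2

/-- The expected cumulative regret over `T` rounds. -/
def CBR.regret {U K : ℕ} (I : CBR U K) (T : ℕ) (A : Learner U K) : ℝ :=
  T * sSup (matchValue I.mean '' {π | Feasible I.c I.B π})
    - ∫ x, ∑ t ∈ Finset.range T, ∑ u, x (t, u, A.play x t u) ∂I.law

/-! ### Single-peaked matrices -/

/-- The sequence is non-decreasing up to `p` and non-increasing from `p` on. -/
def IsPeak {K : ℕ} (f : Fin K → ℝ) (p : Fin K) : Prop :=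
  MonotoneOn f (Set.Iic p) ∧ AntitoneOn f (Set.Ici p)

/-- Perfectly single-peaked matrices. -/
def IsPSP {U K : ℕ} (P : Fin U → Fin K → ℝ) : Prop := ∀ u, ∃ p, IsPeak (P u) p

/-- The matrix with columns permuted according to an order of the arms. An order is a permutation
`σ`, with `σ i` the arm in position `i`. -/
def permCols {U K : ℕ} (P : Fin U → Fin K → ℝ) (σ : Equiv.Perm (Fin K)) : Fin U → Fin K → ℝ :=
  fun u i => P u (σ i)

/-- Single-peaked matrices. -/
def IsSP {U K : ℕ} (P : Fin U → Fin K → ℝ) : Prop :=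
  ∃ σ : Equiv.Perm (Fin K), IsPSP (permCols P σ)

/-! ### Extract-Order -/

/-- The arms of `S` occupy consecutive positions in the order `σ`. -/
def Contiguous {K : ℕ} (σ : Equiv.Perm (Fin K)) (S : Finset (Fin K)) : Prop :=
  ∀ i j l : Fin K, i < j → j < l → σ i ∈ S → σ l ∈ S → σ j ∈ S

/-- The contiguity constraints imposed when the arms are sorted for user `u` as
`τ u 0, τ u 1, …`: the set of the first arms up to position `i`, for every `i` such that the gap
between positions `i` and `i + 1` exceeds `2 * ε`. -/
def orderConstraints {U K : ℕ} (P : Fin U → Fin K → ℝ) (ε : ℝ)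
    (τ : Fin U → Equiv.Perm (Fin K)) : Set (Finset (Fin K)) :=
  {S | ∃ (u : Fin U) (i j : Fin K), (j : ℕ) = i + 1 ∧
    2 * ε < P u (τ u i) - P u (τ u j) ∧ S = (Finset.Iic i).image (τ u)}

/-- `o` is a possible output of Extract-Order on input `(P, ε)`: some order satisfying all the
constraints, or `none` (failure) if there is no such order. -/
def IsExtractOrder {U K : ℕ} (P : Fin U → Fin K → ℝ) (ε : ℝ)
    (o : Option (Equiv.Perm (Fin K))) : Prop :=
  ∃ τ : Fin U → Equiv.Perm (Fin K), (∀ u, Antitone fun i => P u (τ u i)) ∧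
    match o with
    | some σ => ∀ S ∈ orderConstraints P ε τ, Contiguous σ S
    | none => ¬ ∃ σ, ∀ S ∈ orderConstraints P ε τ, Contiguous σ S

/-! ### Projection onto a single-peaked matrix -/

/-- The single-peaked matrix built from `P`, with columns indexed by arms in their given order and
`p u` a maximizer of row `u`: running maxima from the left up to `p u`, from the right after it. -/
def spProject {U K : ℕ} (P : Fin U → Fin K → ℝ) (p : Fin U → Fin K) : Fin U → Fin K → ℝ :=
  fun u k => if k ≤ p u then (Finset.Iic k).sup' Finset.nonempty_Iic (P u)
    else (Finset.Ici k).sup' Finset.nonempty_Ici (P u)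

/-! ### SP-Matching -/

section SPMatching

variable {U K : ℕ} (P : Fin U → Fin K → ℝ) (c : Fin K → ℕ) (p : Fin U → Fin K)

/-- Costs with the auxiliary arm `0`; the arm `k : Fin K` becomes `k.succ`. -/
def extCost : Fin (K + 1) → ℕ := Fin.cons 0 c

/-- The matrix with the auxiliary arm `0`, of reward zero. -/
def extMatrix (u : Fin U) : Fin (K + 1) → ℝ := Fin.cons 0 (P u)

/-- The total reward of the users with peak in `(i, j]` from the better of the arms `i`, `j`. -/
def dpG (i j : Fin (K + 1)) : ℝ :=
  ∑ u with i < (p u).succ ∧ (p u).succ ≤ j, max (extMatrix P u i) (extMatrix P u j)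

/-- The dynamic programming table (consulted only at entries with `extCost c k ≤ b`). -/
def dpF (k : Fin (K + 1)) (b : ℕ) : ℝ :=
  if k = 0 then 0
  else ⨆ i : {i : Fin (K + 1) // i < k ∧ extCost c i + extCost c k ≤ b},
    (dpF i.1 (b - extCost c k) + dpG P p i.1 k)
termination_by k
decreasing_by exact i.2.1

/-- `S` is a set of arms obtained by backtracking in the table from entry `(k, b)`. -/
inductive Backtrack : Fin (K + 1) → ℕ → Finset (Fin K) → Prop
  | base (b : ℕ) : Backtrack 0 b ∅
  | step (k : Fin K) (b : ℕ) (i : Fin (K + 1)) (S : Finset (Fin K)) (hik : i < k.succ)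
      (hb : extCost c i + c k ≤ b)
      (hF : dpF P c p k.succ b = dpF P c p i (b - c k) + dpG P p i k.succ)
      (hS : Backtrack i (b - c k) S) : Backtrack k.succ b (insert k S)

/-- The quantity maximized over the last selected arm. -/
def dpFinal (B : ℕ) (k : Fin K) : ℝ :=
  dpF P c p k.succ B + ∑ u with k < p u, P u k

/-- `π` is a possible output of SP-Matching on the matrix `P` with peaks `p`, costs `c` and
budget `B`. -/
def IsSPMatching (B : ℕ) (π : Matching U K) : Prop :=
  ∃ (k : Fin K) (S : Finset (Fin K)),
    (∀ j, dpFinal P c p B j ≤ dpFinal P c p B k) ∧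
    Backtrack P c p k.succ B S ∧
    ∀ u, π u ∈ S ∧ ∀ j ∈ S, P u j ≤ P u (π u)

end SPMatching

/-! ### Explore-then-Match-and-Commit -/

/-- `π` is a possible commitment given the empirical matrix `M` and the accuracy `ε`: extract an
order `σ`, permute the columns accordingly, project (with row maximizers `p`), and run SP-Matching
(with peaks `q`); the result is translated back to the original arms. If Extract-Order fails, an
arbitrary feasible matching is used. -/
def IsCommitment {U K : ℕ} (c : Fin K → ℕ) (B : ℕ) (M : Fin U → Fin K → ℝ) (ε : ℝ)
    (π : Matching U K) : Prop :=
  ∃ o : Option (Equiv.Perm (Fin K)), IsExtractOrder M ε o ∧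
    match o with
    | none => Feasible c B π
    | some σ => ∃ p q : Fin U → Fin K, ∃ ρ : Matching U K,
        (∀ u i, permCols M σ u i ≤ permCols M σ u (p u)) ∧
        (∀ u, IsPeak (spProject (permCols M σ) p u) (q u)) ∧
        IsSPMatching (spProject (permCols M σ) p) (fun i => c (σ i)) q B ρ ∧
        ∀ u, π u = σ (ρ u)

/-- The empirical mean matrix after exploration: arm `k` is pulled in the rounds `k * N + s`,
`s < N`. -/
def empMean {U K N : ℕ} (h : History U K (K * N)) (u : Fin U) (k : Fin K) : ℝ :=
  (∑ s : Fin N, (h (finProdFinEquiv (k, s))).2 u) / N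

/-- `A` is an implementation of EMC with `N` exploration rounds per arm and horizon `T`: for the
first `K * N` rounds all users are matched with arm `t / N`, and in all later rounds one and the
same matching, computed from the data of the exploration rounds, is played. -/
def IsEMC {U K : ℕ} (c : Fin K → ℕ) (B T N : ℕ) (A : Learner U K) : Prop :=
  (∀ t h u, t < K * N → (A.act t h u : ℕ) = t / N) ∧
  ∃ commit : History U K (K * N) → Matching U K,
    (∀ h, IsCommitment c B (empMean h) (Real.sqrt (2 * Real.log T / N)) (commit h)) ∧
    ∀ (t : ℕ) (ht : K * N ≤ t) (h : History U K t),
      A.act t h = commit fun s => h (Fin.castLE ht s)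

/-- The number of exploration rounds per arm. -/
def emcRounds (T : ℕ) : ℕ :=
  ⌈(T : ℝ) ^ (2 / 3 : ℝ) * (Real.log T) ^ (1 / 3 : ℝ)⌉₊

end

noncomputable section

/-! ### The dynamic program solves single-peaked matching -/

section SPMatchingCorrect

variable {U K : ℕ} {P : Fin U → Fin K → ℝ} {c : Fin K → ℕ} {q : Fin U → Fin K}

/-! Each empirical mean averages `N` independent samples, so by Hoeffding all are within `ε` of the
truth except with probability at most `2UK/T^4` (`measure_inaccurate_le`). The rest of the analysis
of the commitment is deterministic.

If all means are accurate, an empirical gap above `2ε` is a strict gap in `Θ`. The arms above it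
then form an upper level set of a unimodal row, so the true order meets every constraint and
extraction cannot fail (`contiguous_of_mem_orderConstraints`). The extracted order may differ from
the true one, but a dip deeper than `2Kε` on the way to a row maximum would contain a gap above `2ε`
whose constraint it violates (`sub_le_of_contiguous`). Hence projection raises entries by at most
`2Kε`. The dynamic program is exact on the projected matrix (`IsSPMatching.matchValue_le`): a user
with peak between two consecutive selected arms is best served by one of these two. The commitment
thus loses at most `U(2K+2)ε` per round.

Exploration costs at most `UKN`, and the choice of `N` balances this against `T·U(2K+2)ε`. -/

lemma Backtrack.sum_cost_le {k : Fin (K + 1)} {b : ℕ} {S : Finset (Fin K)}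
    (h : Backtrack P c q k b S) (hk : extCost c k ≤ b) : ∑ j ∈ S, c j ≤ b := by
  induction h with
  | base b => simp
  | step k b i S hik hb hF hS ih =>
    have h1 := ih (by omega)
    have h2 : ∑ j ∈ insert k S, c j ≤ c k + ∑ j ∈ S, c j := by
      by_cases hkS : k ∈ S
      · rw [Finset.insert_eq_of_mem hkS]; omega
      · rw [Finset.sum_insert hkS]
    omega

/-- The head of a backtracking chain is either the auxiliary arm, worth `0 ≤ x`, or a member of `S`.
-/
lemma Backtrack.extMatrix_le {k : Fin (K + 1)} {b : ℕ} {S : Finset (Fin K)}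
    (h : Backtrack P c q k b S) {u : Fin U} {x : ℝ} (hx : 0 ≤ x) (hS : ∀ j ∈ S, P u j ≤ x) :
    extMatrix P u k ≤ x := by
  cases h with
  | base b => simpa [extMatrix] using hx
  | step k b i S => simpa [extMatrix] using hS k (Finset.mem_insert_self _ _)

lemma Backtrack.mem {k : Fin (K + 1)} {b : ℕ} {S : Finset (Fin K)}
    (h : Backtrack P c q k b S) {j : Fin K} (hj : k = j.succ) : j ∈ S := by
  cases h with
  | base b => exact absurd hj (Fin.succ_ne_zero j).symm
  | step k b i S => exact Fin.succ_injective _ hj ▸ Finset.mem_insert_self _ _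

lemma sum_peak_le_split (v : Fin U → ℝ) {i k : Fin (K + 1)} (hik : i ≤ k) :
    ∑ u with (q u).succ ≤ k, v u
      = ∑ u with (q u).succ ≤ i, v u + ∑ u with i < (q u).succ ∧ (q u).succ ≤ k, v u := by
  rw [← Finset.sum_filter_add_sum_filter_not (Finset.univ.filter fun u => (q u).succ ≤ k)
    (fun u => (q u).succ ≤ i), Finset.filter_filter, Finset.filter_filter]
  congr 1 <;> refine Finset.sum_congr (Finset.filter_congr fun u _ => ?_) fun _ _ => rfl
  · exact ⟨fun h => h.2, fun h => ⟨h.trans hik, h⟩⟩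
  · rw [not_le, and_comm]

/-- A set obtained by backtracking attains at least the value in the table. -/
lemma Backtrack.dpF_le {k : Fin (K + 1)} {b : ℕ} {S : Finset (Fin K)}
    (h : Backtrack P c q k b S) {v : Fin U → ℝ} (hv : ∀ u, 0 ≤ v u)
    (hS : ∀ u, ∀ j ∈ S, P u j ≤ v u) :
    dpF P c q k b ≤ ∑ u with (q u).succ ≤ k, v u := by
  induction h with
  | base b => rw [dpF, if_pos rfl]; exact Finset.sum_nonneg fun u _ => hv u
  | step k b i S hik hb hF hT ih =>
    rw [hF, sum_peak_le_split v hik.le]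
    have hS' : ∀ u, ∀ j ∈ S, P u j ≤ v u := fun u j hj => hS u j (Finset.mem_insert_of_mem hj)
    refine add_le_add (ih hS') (Finset.sum_le_sum fun u _ => max_le ?_ ?_)
    · exact hT.extMatrix_le (hv u) (hS' u)
    · simpa [extMatrix] using hS u k (Finset.mem_insert_self _ _)

lemma le_dpF {k i : Fin (K + 1)} {b : ℕ} (hik : i < k) (hb : extCost c i + extCost c k ≤ b) :
    dpF P c q i (b - extCost c k) + dpG P q i k ≤ dpF P c q k b := by
  conv_rhs => rw [dpF, if_neg ((Fin.zero_le i).trans_lt hik).ne']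
  exact le_ciSup (f := fun i : {i : Fin (K + 1) // i < k ∧ extCost c i + extCost c k ≤ b} =>
    dpF P c q i.1 (b - extCost c k) + dpG P q i.1 k) (Set.finite_range _).bddAbove ⟨i, hik, hb⟩

/-- The table dominates the value of every affordable set of arms. -/
lemma sum_le_dpF (hq : ∀ u, IsPeak (P u) (q u)) {w : Fin U → ℝ} :
    ∀ (n : ℕ) (S : Finset (Fin K)) (k : Fin K) (b : ℕ), S.card = n → k ∈ S → (∀ s ∈ S, s ≤ k) →
      ∑ s ∈ S, c s ≤ b → (∀ u, q u ≤ k → ∃ s ∈ S, w u ≤ P u s) →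
      ∑ u with (q u).succ ≤ k.succ, w u ≤ dpF P c q k.succ b := by
  intro n
  induction n with
  | zero =>
    intro S k b hS hk
    rw [Finset.card_eq_zero] at hS
    simp [hS] at hk
  | succ n ih =>
    intro S k b hcard hk hmax hcost hw
    have hsum := Finset.add_sum_erase S c hk
    rcases (S.erase k).eq_empty_or_nonempty with hE | hE
    -- With `k` the only arm, its predecessor is the free auxiliary arm, and no peak lies at or
    -- before that one.
    · have h1 := le_dpF (P := P) (c := c) (q := q) (k := k.succ) (i := 0) (b := b)
        (Fin.succ_pos k) (by rw [hE] at hsum; simp [extCost] at hsum ⊢; omega)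
      refine le_trans ?_ h1
      rw [dpF, if_pos rfl, zero_add, dpG]
      rw [sum_peak_le_split w (Fin.succ_pos k).le, Finset.sum_eq_zero, zero_add]
      · refine Finset.sum_le_sum fun u hu => ?_
        simp only [Finset.mem_filter, Finset.mem_univ, true_and, Fin.succ_le_succ_iff] at hu
        obtain ⟨s, hs, hws⟩ := hw u hu.2
        have hsk : s = k := by
          by_contra hne
          have : s ∈ S.erase k := Finset.mem_erase.2 ⟨hne, hs⟩
          simp [hE] at this
        exact hws.trans (by simp [extMatrix, hsk])
      · intro u hu
        simp at hu
    · set i := (S.erase k).max' hE with hi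
      have hiS : i ∈ S.erase k := Finset.max'_mem _ _
      have hik : i < k := lt_of_le_of_ne (hmax i (Finset.mem_of_mem_erase hiS))
        (Finset.ne_of_mem_erase hiS)
      have hile : ∀ s ∈ S.erase k, s ≤ i := fun s hs => Finset.le_max' _ s hs
      have hci : c i ≤ ∑ s ∈ S.erase k, c s := Finset.single_le_sum (f := c) (by simp) hiS
      have h1 := le_dpF (P := P) (c := c) (q := q) (k := k.succ) (i := i.succ) (b := b)
        (Fin.succ_lt_succ_iff.2 hik) (by simp [extCost]; omega)
      refine le_trans ?_ h1
      rw [sum_peak_le_split w (Fin.succ_le_succ_iff.2 hik.le), dpG]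
      refine add_le_add ?_ (Finset.sum_le_sum fun u hu => ?_)
      · refine ih (S.erase k) i _ ?_ hiS hile ?_ fun u hu => ?_
        · rw [Finset.card_erase_of_mem hk, hcard]; rfl
        · simp [extCost]; omega
        · obtain ⟨s, hs, hws⟩ := hw u (hu.trans hik.le)
          by_cases hsk : s = k
          -- A user with peak at or before `i` is past the peak at both arms, so moving from `k`
          -- down to `i` loses nothing.
          · refine ⟨i, hiS, hws.trans ?_⟩
            rw [hsk]
            exact (hq u).2 hu (hu.trans hik.le) hik.le
          · exact ⟨s, Finset.mem_erase.2 ⟨hsk, hs⟩, hws⟩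
      · simp only [Finset.mem_filter, Finset.mem_univ, true_and, Fin.succ_le_succ_iff,
          Fin.succ_lt_succ_iff] at hu
        obtain ⟨s, hs, hws⟩ := hw u hu.2
        simp only [extMatrix, Fin.cons_succ]
        by_cases hsk : s = k
        · exact (hsk ▸ hws).trans (le_max_right _ _)
        · have hsi := hile s (Finset.mem_erase.2 ⟨hsk, hs⟩)
          exact (hws.trans ((hq u).1 (hsi.trans hu.1.le) hu.1.le hsi)).trans (le_max_left _ _)

lemma IsSPMatching.feasible {B : ℕ} {π : Matching U K} (hc : ∀ k, c k ≤ B)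
    (h : IsSPMatching P c q B π) : Feasible c B π := by
  obtain ⟨k, S, -, hS, hπ⟩ := h
  refine le_trans (Finset.sum_le_sum_of_subset ?_) (hS.sum_cost_le (by simpa [extCost] using hc k))
  intro j hj
  obtain ⟨u, -, rfl⟩ := Finset.mem_image.1 hj
  exact (hπ u).1

lemma sum_peak_split (v : Fin U → ℝ) (k : Fin K) :
    ∑ u, v u = ∑ u with (q u).succ ≤ k.succ, v u + ∑ u with k < q u, v u := by
  rw [← Finset.sum_filter_add_sum_filter_not Finset.univ fun u => (q u).succ ≤ k.succ]
  congr 1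
  refine Finset.sum_congr (Finset.filter_congr fun u _ => ?_) fun _ _ => rfl
  simp

/-- SP-Matching is optimal for nonnegative perfectly single-peaked matrices. -/
lemma IsSPMatching.matchValue_le {B : ℕ} {π : Matching U K} (h : IsSPMatching P c q B π)
    (hq : ∀ u, IsPeak (P u) (q u)) (hP : ∀ u k, 0 ≤ P u k) {ρ : Matching U K}
    (hρ : Feasible c B ρ) : matchValue P ρ ≤ matchValue P π := by
  obtain ⟨k, S, hk, hS, hπ⟩ := h
  rcases isEmpty_or_nonempty (Fin U) with hU | ⟨⟨u₀⟩⟩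
  · simp [matchValue]
  set R := Finset.univ.image ρ with hR
  have hRne : R.Nonempty := ⟨ρ u₀, by simp [hR]⟩
  set m := R.max' hRne with hm
  have hle : ∀ u, ρ u ≤ m := fun u => Finset.le_max' _ _ (by simp [hR])
  have h1 : matchValue P ρ ≤ dpFinal P c q B m := by
    rw [matchValue, sum_peak_split (q := q) (fun u => P u (ρ u)) m, dpFinal]
    refine add_le_add ?_ (Finset.sum_le_sum fun u hu => ?_)
    · exact sum_le_dpF hq _ R m B rfl (Finset.max'_mem _ _) (fun s hs => Finset.le_max' _ s hs) hρ
        fun u _ => ⟨ρ u, by simp [hR], le_rfl⟩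
    -- Rows with peak beyond `m` still rise up to `m`, so `m` is the best arm of `ρ` for them.
    · have hu' := (Finset.mem_filter.1 hu).2
      exact (hq u).1 ((hle u).trans hu'.le) hu'.le (hle u)
  have h2 : dpFinal P c q B k ≤ matchValue P π := by
    rw [matchValue, sum_peak_split (q := q) (fun u => P u (π u)) k, dpFinal]
    refine add_le_add (hS.dpF_le (fun u => hP _ _) fun u => (hπ u).2)
      (Finset.sum_le_sum fun u _ => (hπ u).2 k ?_)
    exact hS.mem rfl
  exact h1.trans ((hk m).trans h2)

end SPMatchingCorrect

/-! ### Order extraction and projection -/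

/-- Fewer than `K` unit steps lead from `a` to `b`; drops of at most `δ` each could not add up to
more than `K * δ`. -/
lemma exists_gap_of_antitone {K : ℕ} {f : Fin K → ℝ} {δ : ℝ} (hδ : 0 ≤ δ) {a b : Fin K}
    (hab : a ≤ b) (h : K * δ < f a - f b) :
    ∃ i j : Fin K, (j : ℕ) = i + 1 ∧ a ≤ i ∧ j ≤ b ∧ δ < f i - f j := by
  by_contra! hcon
  have key : ∀ n : ℕ, ∀ x : Fin K, (x : ℕ) = a + n → x ≤ b → f a - f x ≤ n * δ := by
    intro n
    induction n with
    | zero =>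
      intro x hx _
      have : x = a := Fin.ext (by simpa using hx)
      simp [this]
    | succ n ih =>
      intro x hx hxb
      have hlt : (a : ℕ) + n < K := by have := x.2; omega
      have h1 := ih ⟨a + n, hlt⟩ rfl
        (Fin.le_def.2 (by have := Fin.le_def.1 hxb; simp; omega))
      have h2 := hcon ⟨a + n, hlt⟩ x (by simp [hx]; omega) (Fin.le_def.2 (by simp)) hxb
      push_cast
      linarith
  have hab' := Fin.le_def.1 hab
  have h1 := key (b - a) b (by omega) le_rfl
  have h2 : ((b - a : ℕ) : ℝ) * δ ≤ K * δ := by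
    gcongr
    have := b.2
    omega
  linarith

section Order

variable {U K : ℕ} {M Θ : Fin U → Fin K → ℝ} {ε : ℝ}

/-- A peak order of `Θ` meets all constraints extracted from an `ε`-approximation of `Θ`. -/
lemma contiguous_of_mem_orderConstraints {σ : Equiv.Perm (Fin K)} (hσ : IsPSP (permCols Θ σ))
    (hM : ∀ u k, |M u k - Θ u k| ≤ ε) {τ : Fin U → Equiv.Perm (Fin K)}
    (hτ : ∀ u, Antitone fun i => M u (τ u i)) {S : Finset (Fin K)}
    (hS : S ∈ orderConstraints M ε τ) : Contiguous σ S := by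
  obtain ⟨u, a, b, hab, hgap, rfl⟩ := hS
  obtain ⟨p, hp⟩ := hσ u
  -- The empirical gap exceeds `2ε`, which absorbs the errors of both entries.
  have key : ∀ x y, x ∈ (Finset.Iic a).image (τ u) → y ∉ (Finset.Iic a).image (τ u) →
      Θ u y < Θ u x := by
    intro x y hx hy
    obtain ⟨x', hx', rfl⟩ := Finset.mem_image.1 hx
    have h1 : M u (τ u a) ≤ M u (τ u x') := hτ u (Finset.mem_Iic.1 hx')
    have hby : b ≤ (τ u).symm y := by
      by_contra! hlt
      refine hy (Finset.mem_image.2 ⟨(τ u).symm y, Finset.mem_Iic.2 (Fin.le_def.2 ?_), by simp⟩)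
      have := Fin.lt_def.1 hlt
      omega
    have h2 : M u y ≤ M u (τ u b) := by simpa using hτ u hby
    have h3 := abs_le.1 (hM u (τ u x'))
    have h4 := abs_le.1 (hM u y)
    linarith
  intro i j l hij hjl hi hl
  by_contra hj
  -- By unimodality, the value at `j` is at least the one at whichever of `i`, `l` lies on the far
  -- side of `j` from the peak.
  rcases le_total j p with h | h
  · exact absurd (hp.1 (hij.le.trans h) h hij.le) (not_le.2 (key _ _ hi hj))
  · exact absurd (hp.2 h (h.trans hjl.le) hjl.le) (not_le.2 (key _ _ hl hj))

/-- Along an order meeting the constraints, a row can only dip by `2 K ε` below an earlier value on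
the way to its maximum. -/
lemma sub_le_of_contiguous (hε : 0 ≤ ε) {σ : Equiv.Perm (Fin K)} {τ : Fin U → Equiv.Perm (Fin K)}
    (hτ : ∀ u, Antitone fun i => M u (τ u i))
    (hσ : ∀ S ∈ orderConstraints M ε τ, Contiguous σ S) {u : Fin U} {p : Fin K}
    (hp : ∀ i, M u (σ i) ≤ M u (σ p)) {i k : Fin K} (hk : i ≤ k ∧ k ≤ p ∨ p ≤ k ∧ k ≤ i) :
    M u (σ i) - M u (σ k) ≤ 2 * K * ε := by
  by_contra! hlt
  have hpos : 0 ≤ 2 * K * ε := by positivity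
  have hik : i ≠ k := by rintro rfl; linarith
  have hpk : p ≠ k := by rintro rfl; linarith [hp i]
  have hlt' : M u (σ k) < M u (σ i) := by linarith
  set a := (τ u).symm (σ i) with ha
  set b := (τ u).symm (σ k) with hb
  have hτa : τ u a = σ i := by simp [ha]
  have hτb : τ u b = σ k := by simp [hb]
  have hab : a ≤ b := by
    by_contra! h
    have := hτ u h.le
    simp only [hτa, hτb] at this
    linarith
  obtain ⟨x, y, hxy, hax, hyb, hgap⟩ := exists_gap_of_antitone (f := fun i => M u (τ u i))
    (δ := 2 * ε) (by positivity) hab (by simp only [hτa, hτb]; linarith)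
  -- Ties are harmless: every position after `x` has a value strictly below that of `x`. So the
  -- prefix contains `σ i` and the maximizer `σ p`, but not `σ k`, which lies between them.
  have hmem : ∀ z, M u (τ u x) ≤ M u z → z ∈ (Finset.Iic x).image (τ u) := by
    intro z hz
    refine Finset.mem_image.2 ⟨(τ u).symm z, Finset.mem_Iic.2 ?_, by simp⟩
    by_contra! h
    have hyz : y ≤ (τ u).symm z := Fin.le_def.2 (by have := Fin.lt_def.1 h; omega)
    have : M u z ≤ M u (τ u y) := by simpa using hτ u hyz
    linarith
  have hnot : σ k ∉ (Finset.Iic x).image (τ u) := by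
    intro h
    obtain ⟨z, hz, hzk⟩ := Finset.mem_image.1 h
    have hzb : z = b := by rw [hb, ← hzk]; simp
    have h1 := Fin.le_def.1 (Finset.mem_Iic.1 hz)
    have h2 := Fin.le_def.1 hyb
    rw [hzb] at h1
    omega
  have hx : M u (τ u x) ≤ M u (σ i) := hτa ▸ hτ u hax
  have hi := hmem (σ i) hx
  have hp' := hmem (σ p) (hx.trans (hp i))
  have hc := hσ _ ⟨u, x, y, hxy, hgap, rfl⟩
  rcases hk with ⟨h1, h2⟩ | ⟨h1, h2⟩
  · exact hnot (hc i k p (lt_of_le_of_ne h1 hik) (lt_of_le_of_ne h2 hpk.symm) hi hp')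
  · exact hnot (hc p k i (lt_of_le_of_ne h1 hpk) (lt_of_le_of_ne h2 hik.symm) hp' hi)

lemma le_spProject (P : Fin U → Fin K → ℝ) (p : Fin U → Fin K) (u : Fin U) (k : Fin K) :
    P u k ≤ spProject P p u k := by
  unfold spProject
  split_ifs
  · exact Finset.le_sup' (P u) (Finset.mem_Iic.2 le_rfl)
  · exact Finset.le_sup' (P u) (Finset.mem_Ici.2 le_rfl)

lemma spProject_le {P : Fin U → Fin K → ℝ} {p : Fin U → Fin K} {u : Fin U} {δ : ℝ}
    (h : ∀ i k, i ≤ k ∧ k ≤ p u ∨ p u ≤ k ∧ k ≤ i → P u i - P u k ≤ δ) (k : Fin K) :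
    spProject P p u k ≤ P u k + δ := by
  unfold spProject
  split_ifs with hk
  · refine Finset.sup'_le _ _ fun i hi => ?_
    linarith [h i k (Or.inl ⟨Finset.mem_Iic.1 hi, hk⟩)]
  · refine Finset.sup'_le _ _ fun i hi => ?_
    linarith [h i k (Or.inr ⟨(not_le.1 hk).le, Finset.mem_Ici.1 hi⟩)]

lemma feasible_comp_perm_iff {c : Fin K → ℕ} {B : ℕ} (σ : Equiv.Perm (Fin K)) (ρ : Matching U K) :
    Feasible (fun i => c (σ i)) B ρ ↔ Feasible c B fun u => σ (ρ u) := by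
  have : (Finset.univ.image fun u => σ (ρ u)) = (Finset.univ.image ρ).image σ := by
    rw [Finset.image_image]; rfl
  rw [Feasible, Feasible, this, Finset.sum_image fun _ _ _ _ h => σ.injective h]

lemma IsCommitment.feasible {c : Fin K → ℕ} {B : ℕ} (hc : ∀ k, c k ≤ B) {π : Matching U K}
    (h : IsCommitment c B M ε π) : Feasible c B π := by
  obtain ⟨o, -, ho⟩ := h
  cases o with
  | none => exact ho
  | some σ =>
    obtain ⟨p, q, ρ, -, -, hρ, hπ⟩ := ho
    obtain rfl : π = fun u => σ (ρ u) := funext hπ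
    exact (feasible_comp_perm_iff σ ρ).1 (hρ.feasible fun k => hc _)

/-- On an `ε`-approximation of a single-peaked matrix, the commitment is nearly optimal. -/
lemma IsCommitment.matchValue_le {c : Fin K → ℕ} {B : ℕ} {π : Matching U K}
    (h : IsCommitment c B M ε π) (hΘ : IsSP Θ) (hε : 0 ≤ ε) (hM0 : ∀ u k, 0 ≤ M u k)
    (hM : ∀ u k, |M u k - Θ u k| ≤ ε) {π' : Matching U K} (hπ' : Feasible c B π') :
    matchValue Θ π' ≤ matchValue Θ π + U * ((2 * K + 2) * ε) := by
  obtain ⟨o, ⟨τ, hτ, hoτ⟩, ho⟩ := h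
  obtain ⟨σ₀, hσ₀⟩ := hΘ
  cases o with
  | none => exact absurd ⟨σ₀, fun S hS => contiguous_of_mem_orderConstraints hσ₀ hM hτ hS⟩ hoτ
  | some σ =>
    obtain ⟨p, q, ρ, hp, hq, hρ, hπ⟩ := ho
    have hopt := hρ.matchValue_le hq
      (fun u k => (hM0 u (σ k)).trans (le_spProject (permCols M σ) p u k))
      (ρ := fun u => σ.symm (π' u)) ((feasible_comp_perm_iff σ _).2 (by simpa using hπ'))
    -- Projection only raises entries, so the competitor pays just the estimation error `ε`; the
    -- commitment pays `ε` plus the projection error `2Kε`.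
    have h1 : matchValue Θ π' ≤
        matchValue (spProject (permCols M σ) p) (fun u => σ.symm (π' u)) + U * ε := by
      have : (U * ε : ℝ) = ∑ _u : Fin U, ε := by simp
      rw [matchValue, matchValue, this, ← Finset.sum_add_distrib]
      refine Finset.sum_le_sum fun u _ => ?_
      have h2 := le_spProject (permCols M σ) p u (σ.symm (π' u))
      have h3 := abs_le.1 (hM u (π' u))
      simp only [permCols, Equiv.apply_symm_apply] at h2 ⊢
      linarith
    have h2 : matchValue (spProject (permCols M σ) p) ρ ≤
        matchValue Θ π + U * ((2 * K + 1) * ε) := by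
      have : (U * ((2 * K + 1) * ε) : ℝ) = ∑ _u : Fin U, (2 * K + 1) * ε := by simp
      rw [matchValue, matchValue, this, ← Finset.sum_add_distrib]
      refine Finset.sum_le_sum fun u _ => ?_
      have h2 := spProject_le (P := permCols M σ) (p := p) (u := u) (δ := 2 * K * ε)
        (fun i k hk => sub_le_of_contiguous hε hτ hoτ (hp u) hk) (ρ u)
      have h3 := abs_le.1 (hM u (π u))
      rw [hπ u] at h3 ⊢
      simp only [permCols] at h2 ⊢
      linarith
    linarith

end Order

/-! ### The reward table -/

section Law

open ProbabilityTheory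

variable {U K : ℕ} (I : CBR U K)

instance CBR.isProbabilityMeasure_law : IsProbabilityMeasure I.law := by
  have := I.prob
  unfold CBR.law
  infer_instance

lemma CBR.measurePreserving_eval (i : ℕ × Fin U × Fin K) :
    MeasurePreserving (fun x : ℕ × Fin U × Fin K → ℝ => x i) I.law (I.D i.2.1 i.2.2) := by
  have := I.prob
  exact measurePreserving_eval_infinitePi
    (fun i : ℕ × Fin U × Fin K => I.D i.2.1 i.2.2) i

lemma CBR.ae_mem_Icc : ∀ᵐ x ∂I.law, ∀ i, x i ∈ Set.Icc (0 : ℝ) 1 := by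
  rw [ae_all_iff]
  intro i
  have h : ∀ᵐ y ∂I.D i.2.1 i.2.2, y ∈ Set.Icc (0 : ℝ) 1 := I.supp i.2.1 i.2.2
  exact (I.measurePreserving_eval i).quasiMeasurePreserving.ae h

lemma CBR.integral_eval (i : ℕ × Fin U × Fin K) : ∫ x, x i ∂I.law = I.mean i.2.1 i.2.2 := by
  rw [CBR.mean, ← (I.measurePreserving_eval i).map_eq]
  exact (integral_map (I.measurePreserving_eval i).measurable.aemeasurable
    aestronglyMeasurable_id).symm

lemma CBR.integrable_eval (i : ℕ × Fin U × Fin K) : Integrable (fun x => x i) I.law :=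
  Integrable.of_mem_Icc 0 1 (measurable_pi_apply i).aemeasurable
    (I.ae_mem_Icc.mono fun _ h => h i)

lemma CBR.mean_mem_Icc (u : Fin U) (k : Fin K) : I.mean u k ∈ Set.Icc (0 : ℝ) 1 := by
  rw [← I.integral_eval (0, u, k)]
  constructor
  · exact integral_nonneg_of_ae (I.ae_mem_Icc.mono fun x h => (h _).1)
  · have := integral_mono_ae (I.integrable_eval (0, u, k)) (integrable_const (1 : ℝ))
      (I.ae_mem_Icc.mono fun x h => (h _).2)
    simpa using this

lemma CBR.iIndepFun_eval : iIndepFun (fun (i : ℕ × Fin U × Fin K) x => x i) I.law := by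
  have := I.prob
  exact iIndepFun_infinitePi (P := fun i : ℕ × Fin U × Fin K => I.D i.2.1 i.2.2)
    (X := fun _ y => y) fun _ => measurable_id

/-- Hoeffding's inequality for the rewards of one user and arm in distinct rounds. -/
lemma CBR.measure_sum_sub_mean_ge_le (u : Fin U) (k : Fin K) {r : ℕ → ℕ}
    (hr : Function.Injective r) (n : ℕ) {δ : ℝ} (hδ : 0 ≤ δ) :
    I.law.real {x | δ ≤ |∑ s ∈ Finset.range n, (x (r s, u, k) - I.mean u k)|}
      ≤ 2 * Real.exp (-2 * δ ^ 2 / n) := by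
  have hind : iIndepFun (fun (s : ℕ) (x : ℕ × Fin U × Fin K → ℝ) =>
      x (r s, u, k) - I.mean u k) I.law :=
    (I.iIndepFun_eval.precomp (g := fun s : ℕ => (r s, u, k))
      (fun a b h => hr (congrArg Prod.fst h))).comp (fun _ y => y - I.mean u k)
      fun _ => measurable_id.sub_const _
  -- By Hoeffding's lemma, a centred variable with values in an interval of length 1 is sub-Gaussian
  -- with parameter `1/4`.
  have hsub : ∀ s, HasSubgaussianMGF (fun x : ℕ × Fin U × Fin K → ℝ =>
      x (r s, u, k) - I.mean u k) ((‖(1 : ℝ) - 0‖₊ / 2) ^ 2) I.law := by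
    intro s
    have := hasSubgaussianMGF_of_mem_Icc (μ := I.law) (a := 0) (b := 1)
      (X := fun x => x (r s, u, k)) (measurable_pi_apply _).aemeasurable
      (I.ae_mem_Icc.mono fun _ h => h _)
    rwa [I.integral_eval] at this
  have hexp : -δ ^ 2 / (2 * n * (((‖(1 : ℝ) - 0‖₊ / 2) ^ 2 : NNReal) : ℝ))
      = -2 * δ ^ 2 / n := by
    simp
    rcases eq_or_ne (n : ℝ) 0 with h | h
    · simp [h]
    · field_simp
  have h1 := HasSubgaussianMGF.measure_sum_range_ge_le_of_iIndepFun hind (n := n)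
    (fun s _ => hsub s) hδ
  have h2 := HasSubgaussianMGF.measure_sum_range_ge_le_of_iIndepFun
    (hind.comp (fun _ y => -y) fun _ => measurable_neg) (n := n)
    (fun s _ => (hsub s).neg) hδ
  rw [hexp] at h1 h2
  refine le_trans (measureReal_mono (s₂ := _ ∪ _) ?_ (by finiteness))
    ((measureReal_union_le _ _).trans ((add_le_add h1 h2).trans_eq (two_mul _).symm))
  intro x hx
  rcases le_abs.1 hx.out with h | h
  · exact Or.inl h
  · refine Or.inr ?_
    simpa [Function.comp, ← Finset.sum_neg_distrib] using h

end Law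

/-! ### Histories and expected rewards -/

section History

open ProbabilityTheory

variable {U K : ℕ} (A : Learner U K)

lemma Learner.history_apply (x : ℕ × Fin U × Fin K → ℝ) (t : ℕ) (i : Fin t) :
    A.history x t i = (A.play x i, fun u => x (i, u, A.play x i u)) := by
  induction t with
  | zero => exact i.elim0
  | succ t ih =>
    refine Fin.lastCases ?_ (fun j => ?_) i
    · simp [Learner.history, Learner.play]
    · simp [Learner.history, ih]

/-- This causality makes the play of a round independent of the rewards from that round on. -/
lemma Learner.history_congr {x y : ℕ × Fin U × Fin K → ℝ} {t : ℕ}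
    (h : ∀ i, i.1 < t → x i = y i) : A.history x t = A.history y t := by
  induction t with
  | zero => rfl
  | succ t ih =>
    simp only [Learner.history, ih fun i hi => h i (hi.trans (Nat.lt_succ_self t)),
      h (t, _, _) (Nat.lt_succ_self t)]

/-- The coordinate being read depends on `x`; splitting over the finitely many arms reduces to fixed
coordinates. -/
lemma measurable_reward {f : (ℕ × Fin U × Fin K → ℝ) → Matching U K} (hf : Measurable f)
    (t : ℕ) (u : Fin U) : Measurable fun x : ℕ × Fin U × Fin K → ℝ => x (t, u, f x u) := by
  have : (fun x : ℕ × Fin U × Fin K → ℝ => x (t, u, f x u))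
      = fun x => ∑ k, {x | f x u = k}.indicator (fun x => x (t, u, k)) x := by
    ext x
    simp [Set.indicator_apply]
  rw [this]
  refine Finset.measurable_sum _ fun k _ => (measurable_pi_apply _).indicator ?_
  exact ((measurable_pi_apply u).comp hf) (measurableSet_singleton k)

lemma Learner.measurable_history (t : ℕ) : Measurable fun x => A.history x t := by
  induction t with
  | zero => exact measurable_const
  | succ t ih =>
    have hact := (A.measurable_act t).comp ih
    refine measurable_pi_lambda _ fun i => ?_
    refine Fin.lastCases ?_ (fun j => ?_) i
    · simp only [Learner.history, Fin.snoc_last]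
      exact hact.prodMk (measurable_pi_lambda _ fun u => measurable_reward hact t u)
    · simp only [Learner.history, Fin.snoc_castSucc]
      exact (measurable_pi_apply j).comp ih

lemma Learner.measurable_play (t : ℕ) : Measurable fun x => A.play x t :=
  (A.measurable_act t).comp (A.measurable_history t)

variable (I : CBR U K)

/-- The matching of round `s` is independent of the rewards of any round `t ≥ s`. -/
lemma CBR.indepFun_play {s t : ℕ} (hst : s ≤ t) (u : Fin U) (k : Fin K) :
    IndepFun (fun x => A.play x s) (fun x => x (t, u, k)) I.law := by
  set S : Finset (ℕ × Fin U × Fin K) := Finset.range s ×ˢ Finset.univ with hS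
  have hdisj : Disjoint S {(t, u, k)} := by
    simp [hS, hst]
  have h := I.iIndepFun_eval.indepFun_finset S {(t, u, k)} hdisj fun i => measurable_pi_apply i
  -- Padding with zeros outside the rounds before `s` does not change the play, which therefore
  -- factors through finitely many coordinates.
  let ext : (S → ℝ) → (ℕ × Fin U × Fin K → ℝ) := fun y i => if h : i ∈ S then y ⟨i, h⟩ else 0
  have hext : Measurable ext := by
    refine measurable_pi_lambda _ fun i => ?_
    by_cases hi : i ∈ S
    · simpa [ext, hi] using measurable_pi_apply _
    · simp [ext, hi]
  have h2 := h.comp ((A.measurable_play s).comp hext)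
    (measurable_pi_apply (⟨(t, u, k), Finset.mem_singleton_self _⟩ :
      ({(t, u, k)} : Finset (ℕ × Fin U × Fin K))))
  have hplay : (fun x => A.play x s)
      = ((fun x => A.play x s) ∘ ext) ∘ fun x (i : S) => x i := by
    ext1 x
    simp only [Function.comp, Learner.play]
    congr 1
    refine A.history_congr fun i hi => ?_
    have : i ∈ S := by simp [hS, hi]
    simp [ext, this]
  rw [hplay]
  exact h2

lemma CBR.integrable_reward (s t : ℕ) (u : Fin U) :
    Integrable (fun x => x (t, u, A.play x s u)) I.law :=
  Integrable.of_mem_Icc 0 1 (measurable_reward (A.measurable_play s) t u).aemeasurable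
    (I.ae_mem_Icc.mono fun _ h => h _)

lemma CBR.integrable_mean_play (s : ℕ) (u : Fin U) :
    Integrable (fun x => I.mean u (A.play x s u)) I.law :=
  Integrable.of_mem_Icc 0 1
    ((measurable_of_finite (I.mean u)).comp
      ((measurable_pi_apply u).comp (A.measurable_play s))).aemeasurable
    (.of_forall fun _ => I.mean_mem_Icc _ _)

/-- After splitting over the chosen arm, each indicator is independent of the reward it multiplies,
so the expectation factors. -/
lemma CBR.integral_reward {s t : ℕ} (hst : s ≤ t) (u : Fin U) :
    ∫ x, x (t, u, A.play x s u) ∂I.law = ∫ x, I.mean u (A.play x s u) ∂I.law := by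
  have hmeas : ∀ k : Fin K, Measurable (({k} : Set (Fin K)).indicator (1 : Fin K → ℝ)) :=
    fun k => measurable_of_finite _
  have hk : ∀ k, Integrable (fun x => ({k} : Set (Fin K)).indicator (1 : Fin K → ℝ)
      (A.play x s u) * x (t, u, k)) I.law := fun k => by
    refine Integrable.of_mem_Icc 0 1 (((hmeas k).comp
      ((measurable_pi_apply u).comp (A.measurable_play s))).mul
        (measurable_pi_apply _)).aemeasurable (I.ae_mem_Icc.mono fun x h => ?_)
    by_cases hx : A.play x s u = k
    · simpa [hx] using h _
    · simp [hx]
  have hk' : ∀ k, Integrable (fun x => ({k} : Set (Fin K)).indicator (1 : Fin K → ℝ)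
      (A.play x s u) * I.mean u k) I.law := fun k => by
    refine Integrable.of_mem_Icc 0 1 (((hmeas k).comp
      ((measurable_pi_apply u).comp (A.measurable_play s))).mul_const _).aemeasurable
        (.of_forall fun x => ?_)
    by_cases hx : A.play x s u = k
    · simpa [hx] using I.mean_mem_Icc u k
    · simp [hx]
  have h1 : ∀ x : ℕ × Fin U × Fin K → ℝ, x (t, u, A.play x s u) = ∑ k,
      ({k} : Set (Fin K)).indicator (1 : Fin K → ℝ) (A.play x s u) * x (t, u, k) := fun x => by
    simp [Set.indicator_apply]
  have h2 : ∀ x : ℕ × Fin U × Fin K → ℝ, I.mean u (A.play x s u) = ∑ k,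
      ({k} : Set (Fin K)).indicator (1 : Fin K → ℝ) (A.play x s u) * I.mean u k := fun x => by
    simp [Set.indicator_apply]
  simp only [h1, h2]
  rw [integral_finsetSum _ fun k _ => hk k, integral_finsetSum _ fun k _ => hk' k]
  refine Finset.sum_congr rfl fun k _ => ?_
  have hind := (I.indepFun_play A hst u k).comp ((hmeas k).comp (measurable_pi_apply u))
    measurable_id
  have h3 := hind.integral_mul_eq_mul_integral
    ((hmeas k).comp ((measurable_pi_apply u).comp (A.measurable_play s))).aestronglyMeasurable
    (measurable_pi_apply _).aestronglyMeasurable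
  rw [integral_mul_const, ← I.integral_eval (t, u, k)]
  exact h3

lemma CBR.integrable_matchValue_play (t : ℕ) :
    Integrable (fun x => matchValue I.mean (A.play x t)) I.law :=
  integrable_finsetSum _ fun u _ => I.integrable_mean_play A t u

lemma CBR.integral_total_reward (T : ℕ) :
    ∫ x, ∑ t ∈ Finset.range T, ∑ u, x (t, u, A.play x t u) ∂I.law
      = ∑ t ∈ Finset.range T, ∫ x, matchValue I.mean (A.play x t) ∂I.law := by
  rw [integral_finsetSum _ fun t _ => integrable_finsetSum _ fun u _ =>
    I.integrable_reward A t t u]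
  refine Finset.sum_congr rfl fun t _ => ?_
  simp only [matchValue]
  rw [integral_finsetSum _ fun u _ => I.integrable_reward A t t u,
    integral_finsetSum _ fun u _ => I.integrable_mean_play A t u]
  exact Finset.sum_congr rfl fun u _ => I.integral_reward A le_rfl u

lemma CBR.matchValue_mem_Icc (π : Matching U K) : matchValue I.mean π ∈ Set.Icc (0 : ℝ) U := by
  refine ⟨Finset.sum_nonneg fun u _ => (I.mean_mem_Icc u _).1, ?_⟩
  have := Finset.sum_le_sum fun u (_ : u ∈ Finset.univ) => (I.mean_mem_Icc u (π u)).2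
  simpa [matchValue] using this

end History

/-! ### The regret of explore-then-match-and-commit -/

section Regret

variable {U K : ℕ} {I : CBR U K} {T N : ℕ} {A : Learner U K}

lemma IsEMC.play_explore (hA : IsEMC I.c I.B T N A) (x : ℕ × Fin U × Fin K → ℝ) {t : ℕ}
    (ht : t < K * N) (u : Fin U) : (A.play x t u : ℕ) = t / N :=
  hA.1 t _ u ht

lemma IsEMC.empMean_history (hA : IsEMC I.c I.B T N A) (x : ℕ × Fin U × Fin K → ℝ) (u : Fin U)
    (k : Fin K) :
    empMean (A.history x (K * N)) u k = (∑ s ∈ Finset.range N, x (s + N * k, u, k)) / N := by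
  rw [empMean, ← Fin.sum_univ_eq_sum_range fun s => x (s + N * k, u, k)]
  congr 1
  refine Finset.sum_congr rfl fun s _ => ?_
  rw [A.history_apply]
  have hk : A.play x (finProdFinEquiv (k, s)) u = k := by
    refine Fin.ext ((hA.play_explore x (finProdFinEquiv (k, s)).2 u).trans ?_)
    rw [finProdFinEquiv_apply_val, Nat.add_mul_div_left _ _ s.pos, Nat.div_eq_of_lt s.2, zero_add]
  simp only [hk]
  rfl

lemma IsEMC.isCommitment (hA : IsEMC I.c I.B T N A) (x : ℕ × Fin U × Fin K → ℝ) {t : ℕ}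
    (ht : K * N ≤ t) :
    A.play x t = A.play x (K * N) ∧ IsCommitment I.c I.B (empMean (A.history x (K * N)))
      (Real.sqrt (2 * Real.log T / N)) (A.play x (K * N)) := by
  obtain ⟨commit, hc, hact⟩ := hA.2
  have h0 : A.play x (K * N) = commit (A.history x (K * N)) := hact _ le_rfl _
  refine ⟨?_, h0 ▸ hc _⟩
  rw [h0, Learner.play, hact t ht]
  congr 1
  ext1 s
  rw [A.history_apply, A.history_apply]
  rfl

/-- The budget covers each single arm. This settles the exploration rounds and shows that feasible
matchings exist. -/
lemma feasible_of_forall_eq {c : Fin K → ℕ} {B : ℕ} (hc : ∀ k, c k ≤ B) {π : Matching U K}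
    (h : ∀ u v, π u = π v) : Feasible c B π := by
  rcases isEmpty_or_nonempty (Fin U) with hU | ⟨⟨u⟩⟩
  · simp [Feasible]
  · have : Finset.univ.image π ⊆ {π u} := by
      intro k hk
      obtain ⟨v, -, rfl⟩ := Finset.mem_image.1 hk
      exact Finset.mem_singleton.2 (h v u)
    exact (Finset.sum_le_sum_of_subset this).trans (by simpa using hc (π u))

lemma IsEMC.feasible (hA : IsEMC I.c I.B T N A) (t : ℕ) (h : History U K t) :
    Feasible I.c I.B (A.act t h) := by
  rcases lt_or_ge t (K * N) with ht | ht
  · exact feasible_of_forall_eq I.cost_le fun u v =>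
      Fin.ext ((hA.1 t h u ht).trans (hA.1 t h v ht).symm)
  · obtain ⟨commit, hc, hact⟩ := hA.2
    rw [hact t ht]
    exact (hc _).feasible I.cost_le

/-- The rewards of exploration on which some empirical mean is inaccurate. -/
def inaccurate (I : CBR U K) (N : ℕ) (ε : ℝ) : Set (ℕ × Fin U × Fin K → ℝ) :=
  ⋃ (u : Fin U) (k : Fin K),
    {x | N * ε ≤ |∑ s ∈ Finset.range N, (x (s + N * k, u, k) - I.mean u k)|}

lemma measurableSet_inaccurate (I : CBR U K) (N : ℕ) (ε : ℝ) :
    MeasurableSet (inaccurate I N ε) := by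
  refine .iUnion fun u => .iUnion fun k => measurableSet_le measurable_const ?_
  have h := Finset.measurable_sum (Finset.range N) fun s _ =>
    (measurable_pi_apply (X := fun _ : ℕ × Fin U × Fin K => ℝ) (s + N * k, u, k)).sub_const
      (I.mean u k)
  exact continuous_abs.measurable.comp h

/-- At deviation `N * ε` the Hoeffding exponent is `-2Nε² = -4 log T`; a union bound over users and
arms finishes. -/
lemma measure_inaccurate_le (I : CBR U K) (hT : 1 ≤ T) (hN : 1 ≤ N) :
    I.law.real (inaccurate I N (Real.sqrt (2 * Real.log T / N))) ≤ U * K * (2 / (T : ℝ) ^ 4) := by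
  have hN' : (0 : ℝ) < N := by exact_mod_cast hN
  have hT' : (0 : ℝ) < T := by exact_mod_cast hT
  have hlog : 0 ≤ Real.log T := Real.log_nonneg (by exact_mod_cast hT)
  have hone : ∀ (u : Fin U) (k : Fin K), I.law.real
      {x | N * Real.sqrt (2 * Real.log T / N)
        ≤ |∑ s ∈ Finset.range N, (x (s + N * k, u, k) - I.mean u k)|} ≤ 2 / (T : ℝ) ^ 4 := by
    intro u k
    refine (I.measure_sum_sub_mean_ge_le u k (r := fun s => s + N * k)
      (add_left_injective _) N (by positivity)).trans_eq ?_
    rw [mul_pow, Real.sq_sqrt (by positivity)]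
    have : -2 * ((N : ℝ) ^ 2 * (2 * Real.log T / N)) / N = -Real.log ((T : ℝ) ^ 4) := by
      rw [Real.log_pow]
      push_cast
      field_simp
      ring
    rw [this, Real.exp_neg, Real.exp_log (by positivity)]
    rfl
  refine (measureReal_iUnion_fintype_le _).trans ?_
  refine (Finset.sum_le_sum fun u _ => (measureReal_iUnion_fintype_le _).trans
    (Finset.sum_le_sum fun k _ => hone u k)).trans_eq ?_
  simp
  ring

lemma IsEMC.abs_empMean_sub_le (hA : IsEMC I.c I.B T N A) (hN : 1 ≤ N) {ε : ℝ}
    {x : ℕ × Fin U × Fin K → ℝ} (hx : x ∉ inaccurate I N ε) (u : Fin U) (k : Fin K) :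
    |empMean (A.history x (K * N)) u k - I.mean u k| ≤ ε := by
  have hN' : (0 : ℝ) < N := by exact_mod_cast hN
  simp only [inaccurate, Set.mem_iUnion, not_exists] at hx
  have h : |∑ s ∈ Finset.range N, (x (s + N * k, u, k) - I.mean u k)| < N * ε :=
    not_le.1 (hx u k)
  rw [hA.empMean_history]
  have : (∑ s ∈ Finset.range N, x (s + N * k, u, k)) / N - I.mean u k
      = (∑ s ∈ Finset.range N, (x (s + N * k, u, k) - I.mean u k)) / N := by
    rw [Finset.sum_sub_distrib]
    simp
    field_simp
  rw [this, abs_div, abs_of_pos hN', div_le_iff₀ hN']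
  linarith

/-- The expected value of the matching that the learner commits to. -/
lemma IsEMC.le_integral_commit (hA : IsEMC I.c I.B T N A) (hSP : IsSP I.mean) (hT : 1 ≤ T)
    (hN : 1 ≤ N) {π : Matching U K} (hπ : Feasible I.c I.B π) :
    matchValue I.mean π - U * ((2 * K + 2) * Real.sqrt (2 * Real.log T / N))
        - U * (U * K * (2 / (T : ℝ) ^ 4))
      ≤ ∫ x, matchValue I.mean (A.play x (K * N)) ∂I.law := by
  set ε := Real.sqrt (2 * Real.log T / N) with hε
  have hε0 : 0 ≤ ε := Real.sqrt_nonneg _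
  set E := inaccurate I N ε with hE
  have hEm : MeasurableSet E := measurableSet_inaccurate I N ε
  have hind : Integrable (fun x => U * E.indicator (1 : (ℕ × Fin U × Fin K → ℝ) → ℝ) x) I.law :=
    ((integrable_const (1 : ℝ)).indicator hEm).const_mul _
  have hint : Integrable (fun x => matchValue I.mean π - U * ((2 * K + 2) * ε)
      - U * E.indicator (1 : (ℕ × Fin U × Fin K → ℝ) → ℝ) x) I.law :=
    (integrable_const _).sub hind
  have hmono := integral_mono_ae hint (I.integrable_matchValue_play A (K * N)) (by
    filter_upwards [I.ae_mem_Icc] with x hx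
    by_cases hxE : x ∈ E
    -- On inaccurate data the bound is trivial, since values of matchings lie in `[0, U]`.
    · have h1 := (I.matchValue_mem_Icc π).2
      have h2 := (I.matchValue_mem_Icc (A.play x (K * N))).1
      have h3 : 0 ≤ U * ((2 * K + 2) * ε) := by positivity
      simp only [Set.indicator_of_mem hxE, Pi.one_apply]
      linarith
    · have h := (hA.isCommitment x le_rfl).2.matchValue_le hSP hε0 (fun u k => ?_)
        (hA.abs_empMean_sub_le hN hxE) hπ
      · simp only [Set.indicator_of_notMem hxE]
        linarith
      · rw [hA.empMean_history]
        exact div_nonneg (Finset.sum_nonneg fun s _ => (hx _).1) N.cast_nonneg)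
  refine le_trans ?_ hmono
  rw [integral_sub (integrable_const _) hind, integral_const_mul, integral_indicator_one hEm]
  have := mul_le_mul_of_nonneg_left (measure_inaccurate_le I hT hN) (Nat.cast_nonneg (α := ℝ) U)
  simp only [integral_const, probReal_univ, one_smul]
  linarith

lemma CBR.exists_optimal (I : CBR U K) (hK : 1 ≤ K) : ∃ π, Feasible I.c I.B π ∧
    sSup (matchValue I.mean '' {π | Feasible I.c I.B π}) = matchValue I.mean π := by
  have hne : (matchValue I.mean '' {π | Feasible I.c I.B π}).Nonempty :=
    Set.Nonempty.image _ ⟨fun _ => ⟨0, hK⟩, feasible_of_forall_eq I.cost_le fun _ _ => rfl⟩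
  obtain ⟨π, hπ, h⟩ := hne.csSup_mem (Set.toFinite _)
  exact ⟨π, hπ, h.symm⟩

/-- The regret of EMC, with one term each for exploration, for the accuracy of the empirical
means and for the failure of that accuracy. -/
lemma IsEMC.regret_le (hA : IsEMC I.c I.B T N A) (hSP : IsSP I.mean) (hK : 1 ≤ K) (hT : 1 ≤ T)
    (hN : 1 ≤ N) :
    I.regret T A ≤ U * (K * N) + T * (U * ((2 * K + 2) * Real.sqrt (2 * Real.log T / N))
      + U * (U * K * (2 / (T : ℝ) ^ 4))) := by
  obtain ⟨π, hπ, hopt⟩ := I.exists_optimal hK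
  rw [CBR.regret, hopt, I.integral_total_reward]
  set δ := U * ((2 * K + 2) * Real.sqrt (2 * Real.log T / N)) + U * (U * K * (2 / (T : ℝ) ^ 4))
    with hδ
  have hδ0 : 0 ≤ δ := by positivity
  have hcommit : ∀ t, K * N ≤ t → matchValue I.mean π - δ
      ≤ ∫ x, matchValue I.mean (A.play x t) ∂I.law := by
    intro t ht
    simp only [fun x => (hA.isCommitment x ht).1]
    linarith [hA.le_integral_commit hSP hT hN hπ]
  have hnonneg : ∀ t, 0 ≤ ∫ x, matchValue I.mean (A.play x t) ∂I.law := fun t =>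
    integral_nonneg fun x => (I.matchValue_mem_Icc _).1
  have hπU := I.matchValue_mem_Icc π
  -- An exploration round is charged the full `U`. If `T ≤ K * N`, every round is of this kind and
  -- the bound persists.
  have hround : ∀ t ∈ Finset.range T, matchValue I.mean π - δ - (if t < K * N then (U : ℝ) else 0)
      ≤ ∫ x, matchValue I.mean (A.play x t) ∂I.law := by
    intro t _
    split_ifs with ht
    · linarith [hnonneg t, hπU.2]
    · linarith [hcommit t (not_lt.1 ht)]
  have hsum := Finset.sum_le_sum hround
  have hexp : ∑ t ∈ Finset.range T, (if t < K * N then (U : ℝ) else 0) ≤ U * (K * N) := by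
    rw [← Finset.sum_filter, Finset.sum_const, nsmul_eq_mul, mul_comm]
    refine mul_le_mul_of_nonneg_left ?_ U.cast_nonneg
    have : (Finset.range T).filter (· < K * N) ⊆ Finset.range (K * N) := fun t ht =>
      Finset.mem_range.2 (Finset.mem_filter.1 ht).2
    have := Finset.card_le_card this
    rw [Finset.card_range] at this
    exact_mod_cast this
  rw [Finset.sum_sub_distrib, Finset.sum_const, Finset.card_range, nsmul_eq_mul] at hsum
  linarith

/-- With a single user and a single arm there is no regret. -/
lemma CBR.regret_eq_zero (I : CBR U K) [Subsingleton (Matching U K)] (hK : 1 ≤ K) (T : ℕ)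
    (A : Learner U K) : I.regret T A = 0 := by
  obtain ⟨π, -, hopt⟩ := I.exists_optimal hK
  rw [CBR.regret, hopt, I.integral_total_reward]
  simp [fun x t => Subsingleton.elim (A.play x t) π]

end Regret

/-- Cubing clears the fractional exponents, which makes the final estimates polynomial. -/
lemma cube_rpow_mul_log_rpow {T : ℕ} (hT : 1 ≤ T) :
    ((T : ℝ) ^ (2 / 3 : ℝ) * (Real.log T) ^ (1 / 3 : ℝ)) ^ 3 = (T : ℝ) ^ 2 * Real.log T := by
  have hlog : 0 ≤ Real.log T := Real.log_nonneg (by exact_mod_cast hT)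
  rw [mul_pow, ← Real.rpow_mul_natCast T.cast_nonneg, ← Real.rpow_mul_natCast hlog]
  norm_num

theorem mainTheorem2 :
    ∃ C : ℝ, 0 < C ∧
      ∀ (T U K : ℕ), 1 ≤ U → 1 ≤ K → U ≤ T → K ≤ T →
      ∀ (I : CBR U K), IsSP I.mean →
      ∀ (A : Learner U K), IsEMC I.c I.B T (emcRounds T) A →
        (∀ (t : ℕ) (h : History U K t), Feasible I.c I.B (A.act t h)) ∧
        I.regret T A ≤
          C * (U * K * (T : ℝ) ^ (2 / 3 : ℝ) * (Real.log T) ^ (1 / 3 : ℝ)) := by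
  -- 12 = 2 + 8 + 2, for exploration, accuracy and failure.
  refine ⟨12, by norm_num, fun T U K hU hK hUT hKT I hSP A hA => ⟨hA.feasible, ?_⟩⟩
  have hT : 1 ≤ T := hU.trans hUT
  have hcube := cube_rpow_mul_log_rpow hT
  have hlog : 0 ≤ Real.log T := Real.log_nonneg (by exact_mod_cast hT)
  have hx0 : 0 ≤ (T : ℝ) ^ (2 / 3 : ℝ) * (Real.log T) ^ (1 / 3 : ℝ) := by positivity
  rw [mul_assoc (U * K : ℝ)]
  -- For `T = 1` the right side vanishes because `log 1 = 0`, so the regret must be exactly zero.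
  rcases hT.eq_or_lt with rfl | hT2
  · obtain rfl : U = 1 := le_antisymm hUT hU
    obtain rfl : K = 1 := le_antisymm hKT hK
    rw [I.regret_eq_zero le_rfl]
    positivity
  have hN : (T : ℝ) ^ (2 / 3 : ℝ) * (Real.log T) ^ (1 / 3 : ℝ) ≤ emcRounds T := Nat.le_ceil _
  have hN2 : (emcRounds T : ℝ) < (T : ℝ) ^ (2 / 3 : ℝ) * (Real.log T) ^ (1 / 3 : ℝ) + 1 :=
    Nat.ceil_lt_add_one hx0
  set x := (T : ℝ) ^ (2 / 3 : ℝ) * (Real.log T) ^ (1 / 3 : ℝ) with hx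
  set N := emcRounds T
  have hT2' : (2 : ℝ) ≤ T := by exact_mod_cast hT2
  have hU' : (1 : ℝ) ≤ U := by exact_mod_cast hU
  have hK' : (1 : ℝ) ≤ K := by exact_mod_cast hK
  have hUT' : (U : ℝ) ≤ T := by exact_mod_cast hUT
  -- Since `x³ = T² log T ≥ 4 log 2 > 1`. This gives `N ≤ 2x` despite the ceiling, and absorbs the
  -- failure term.
  have hx1 : 1 ≤ x := by
    by_contra! h
    have h1 : x ^ 3 < 1 := pow_lt_one₀ hx0 h (by norm_num)
    have h2 : Real.log 2 ≤ Real.log T := Real.log_le_log (by norm_num) hT2'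
    have h3 := Real.log_two_gt_d9
    nlinarith
  have hNpos : (0 : ℝ) < N := by linarith
  have hε : T * Real.sqrt (2 * Real.log T / N) ≤ 2 * x := by
    -- As `N ≥ x`, the square of the left side is `2x³/N ≤ 2x²`.
    refine abs_le_of_sq_le_sq' ?_ (by positivity) |>.2
    rw [mul_pow, Real.sq_sqrt (by positivity), ← mul_div_assoc, div_le_iff₀ hNpos]
    nlinarith [mul_le_mul_of_nonneg_left hN (sq_nonneg x)]
  have hfail : (T : ℝ) * (U * (U * K * (2 / (T : ℝ) ^ 4))) ≤ 2 * (U * K) := by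
    have : (T : ℝ) * (U * (U * K * (2 / (T : ℝ) ^ 4))) = 2 * (U * K) * (U / (T : ℝ) ^ 3) := by
      field_simp
    rw [this]
    -- The extra factor `U` is absorbed by `U ≤ T ≤ T³`.
    refine mul_le_of_le_one_right (by positivity) ((div_le_one (by positivity)).2 ?_)
    exact hUT'.trans (le_self_pow₀ (by linarith) (by norm_num))
  refine (hA.regret_le hSP hK hT (by exact_mod_cast hNpos)).trans ?_
  have hUK : (0 : ℝ) < U * K := by positivity
  have h1 : (U : ℝ) * (K * N) ≤ 2 * (U * K * x) := by nlinarith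
  have h2 : (U : ℝ) * (2 * K + 2) * (T * Real.sqrt (2 * Real.log T / N)) ≤ 8 * (U * K * x) := by
    have : (U : ℝ) * (2 * K + 2) ≤ 4 * (U * K) := by nlinarith
    calc _ ≤ 4 * (U * K) * (2 * x) := by gcongr
      _ = _ := by ring
  have h3 : (U * K : ℝ) ≤ U * K * x := le_mul_of_one_le_right hUK.le hx1
  linarith

end
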